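/- Let $n\ge 2$, $\sigma\in(0,2)$ and $\lambda,\Lambda>0$. Write $\delta(u,x,y)=u(x+y)+u(x-y)-2u(x)$ and, with $\mathcal A(n,-\sigma)=\frac{2^\sigma\Gamma((n+\sigma)/2)}{\pi^{n/2}|\Gamma(-\sigma/2)|}$, $$D^\sigma u(x)=\frac{\mathcal A(n,-\sigma)}{2}\int_{\mathbb R^n}\delta(u,x,y)\frac{y\otimes y}{|y|^{n+2+\sigma}}\,dy,\qquad Iu(x)=\inf_{\beta\in\mathscr B}\operatorname{Tr}\big(A_\beta(x)D^\sigma u(x)\big),$$ where $\mathscr B$ is a nonempty index set and, for every $\beta\in\mathscr B$ and $x\in\mathbb R^n$, $A_\beta(x)$ is a real symmetric $n\times n$ matrix with $A_\beta(x)\ge O$ and $\lambda\,\mathrm{Id}\le\frac1{n+\sigma}\{\sigma A_\beta(x)+\operatorname{Tr}(A_\beta(x))\mathrm{Id}\}\le\Lambda\,\mathrm{Id}$. We say that $Iu(x)$ is defined if the integral in $D^\sigma u(x)$ converges absolutely and the infimum is finite. Assume that $I$ is translation invariant: $(Iu)(x+z)=I[u(\cdot+z)](x)$ for all $x,z\in\mathbb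 R^n$ and all $u$ for which the left-hand side is defined. A lower semicontinuous bounded function $u:\mathbb R^n\to\mathbb R$ is a viscosity supersolution of $Iu=f$ (or $Iu\le f$) in $\mathbb R^n$, where $f:\mathbb R^n\to[-\infty,\infty]$, if, whenever $N$ is an open neighbourhood of a point $x$, $\varphi\in C^2(\overline N)$ is bounded on $N$, $\varphi(x)=u(x)$ and $\varphi\le u$ in $N$, the function $v$ equal to $\varphi$ in $N$ and to $u$ in $\mathbb R^n\setminus N$ satisfies $Iv(x)\le f(x)$. For $h>0$ let $u_h(x)=\inf_{y\in\mathbb R^n}\{u(y)+\frac1{2h}|x-y|^2\}$. For $\varphi\in C_0^\infty(B_1)$ with $\varphi\ge0$ and $\int\varphi=1$, and $\varepsilon>0$, let $u_{h,\varepsilon}=u_h*(\varepsilon^{-n}\varphi(\varepsilon^{-1}\,\cdot))$. Write $\|u\|_\infty=\sup_{\mathbb R^n}|u|$. Then there is a constant $C>0$ depending only on $n,\sigma,\lambda,\Lambda$ such that, for every such translation invariant $I$, every $f:\mathbb R^n\to\mathbb R$, every lower semicontinuous bounded viscosity supersolution $u$ of $Iu=f$ in $\mathbb R^n$, and every $h>0$: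 (i) $Iu_h(x)$ is defined for a.e. $x\in\mathbb R^n$. (ii) $u_h$ is (bounded, lower semicontinuous and) a viscosity supersolution of $$Iu_h(x)\le \sup_{|x-y|\le 2\sqrt{h\|u\|_\infty}}f(y)\quad\text{in }\mathbb R^n$$ (the supremum is a maximum if, e.g., $f$ is continuous). (iii) For every $\varphi$ as above, $Iu_{h,\varepsilon}(x)$ is defined and $Iu_{h,\varepsilon}(x)\le C\max\{h^{-1},\|u\|_\infty\}$ for all $x\in\mathbb R^n$ and $\varepsilon>0$; moreover $Iu_{h,\varepsilon}(x)\to Iu_h(x)$ for a.e. $x\in\mathbb R^n$ as $\varepsilon\to0^+$. -/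

import Mathlib

open scoped ContDiff Topology

namespace NonlocalInfConv

noncomputable section

/-- Second order difference `δ(u, x, y) = u (x + y) + u (x - y) - 2 u x`. -/
def secondDiff {n : ℕ} (u : EuclideanSpace ℝ (Fin n) → ℝ) (x y : EuclideanSpace ℝ (Fin n)) : ℝ :=
  u (x + y) + u (x - y) - 2 * u x

/-- The normalizing constant `𝒜(n, -σ) = 2^σ Γ((n+σ)/2) / (π^{n/2} |Γ(-σ/2)|)`. -/
def normConst (n : ℕ) (σ : ℝ) : ℝ :=
  2 ^ σ * Real.Gamma ((n + σ) / 2) / (Real.pi ^ ((n : ℝ) / 2) * |Real.Gamma (-σ / 2)|)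

/-- The `(i, j)` entry `δ(u, x, y) y_i y_j / |y|^{n+2+σ}` of the integrand of the fractional
Hessian. -/
def hessianIntegrand {n : ℕ} (σ : ℝ) (u : EuclideanSpace ℝ (Fin n) → ℝ)
    (x : EuclideanSpace ℝ (Fin n)) (i j : Fin n) (y : EuclideanSpace ℝ (Fin n)) : ℝ :=
  secondDiff u x y * (y i * y j) / ‖y‖ ^ ((n : ℝ) + 2 + σ)

/-- The fractional Hessian `D^σ u (x)`, computed entrywise. -/
def fracHessian {n : ℕ} (σ : ℝ) (u : EuclideanSpace ℝ (Fin n) → ℝ)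
    (x : EuclideanSpace ℝ (Fin n)) : Matrix (Fin n) (Fin n) ℝ :=
  Matrix.of fun i j => normConst n σ / 2 * ∫ y, hessianIntegrand σ u x i j y

/-- The matrix `A_σ = (σ A + Tr(A) Id) / (n + σ)`. -/
def sigmaMatrix {n : ℕ} (σ : ℝ) (A : Matrix (Fin n) (Fin n) ℝ) : Matrix (Fin n) (Fin n) ℝ :=
  ((n : ℝ) + σ)⁻¹ • (σ • A + A.trace • (1 : Matrix (Fin n) (Fin n) ℝ))

/-- The set `S_{λ,Λ}` of real symmetric matrices with `A ≥ O` and `λ Id ≤ A_σ ≤ Λ Id`. -/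
def ellipticSet (n : ℕ) (σ lam Lam : ℝ) : Set (Matrix (Fin n) (Fin n) ℝ) :=
  {A | A.PosSemidef ∧
    (sigmaMatrix σ A - lam • (1 : Matrix (Fin n) (Fin n) ℝ)).PosSemidef ∧
    (Lam • (1 : Matrix (Fin n) (Fin n) ℝ) - sigmaMatrix σ A).PosSemidef}

/-- The nonlocal operator `I u (x) = inf_β Tr (A_β(x) D^σ u (x))`. -/
def nonlocalOp {n : ℕ} {B : Type*} (σ : ℝ)
    (A : B → EuclideanSpace ℝ (Fin n) → Matrix (Fin n) (Fin n) ℝ)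
    (u : EuclideanSpace ℝ (Fin n) → ℝ) (x : EuclideanSpace ℝ (Fin n)) : ℝ :=
  ⨅ β, (A β x * fracHessian σ u x).trace

/-- `I u (x)` is classically defined: the integrals in `D^σ u (x)` converge absolutely and the
infimum over `β` is finite. -/
def OpDefinedAt {n : ℕ} {B : Type*} (σ : ℝ)
    (A : B → EuclideanSpace ℝ (Fin n) → Matrix (Fin n) (Fin n) ℝ)
    (u : EuclideanSpace ℝ (Fin n) → ℝ) (x : EuclideanSpace ℝ (Fin n)) : Prop :=
  (∀ i j, MeasureTheory.Integrable (hessianIntegrand σ u x i j)) ∧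
    BddBelow (Set.range fun β => (A β x * fracHessian σ u x).trace)

/-- Translation invariance of the operator: `(I u)(x + z) = I [u(· + z)] (x)`, whenever the
left-hand side is defined. -/
def TranslationInvariant {n : ℕ} {B : Type*} (σ : ℝ)
    (A : B → EuclideanSpace ℝ (Fin n) → Matrix (Fin n) (Fin n) ℝ) : Prop :=
  ∀ (u : EuclideanSpace ℝ (Fin n) → ℝ) (x z : EuclideanSpace ℝ (Fin n)),
    OpDefinedAt σ A u (x + z) →
      nonlocalOp σ A u (x + z) = nonlocalOp σ A (fun y => u (y + z)) x

open Classical in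
/-- `u ∈ LSC(ℝⁿ) ∩ L^∞(ℝⁿ)` is a viscosity supersolution of `I u = f` in `ℝⁿ`. Test functions are
`C²` up to the boundary of an open neighbourhood `N` of the contact point and bounded on `N`
(automatic if `N` is bounded); then the function equal to `φ` in `N` and to `u` outside `N` is
bounded and measurable, and `I` of it is classically defined at the contact point. The right-hand
side may take the values `±∞`. -/
structure IsViscositySupersolution {n : ℕ} {B : Type*} (σ : ℝ)
    (A : B → EuclideanSpace ℝ (Fin n) → Matrix (Fin n) (Fin n) ℝ)
    (u : EuclideanSpace ℝ (Fin n) → ℝ) (f : EuclideanSpace ℝ (Fin n) → EReal) : Prop where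
  lsc : LowerSemicontinuous u
  bounded : ∃ K : ℝ, ∀ x, |u x| ≤ K
  test : ∀ (x : EuclideanSpace ℝ (Fin n)) (N : Set (EuclideanSpace ℝ (Fin n)))
    (φ : EuclideanSpace ℝ (Fin n) → ℝ),
    IsOpen N → x ∈ N → ContDiffOn ℝ 2 φ (closure N) → (∃ K : ℝ, ∀ y ∈ N, |φ y| ≤ K) →
    u x = φ x → (∀ y ∈ N, φ y ≤ u y) →
    ((nonlocalOp σ A (N.piecewise φ u) x : ℝ) : EReal) ≤ f x

/-- The supremum norm `‖u‖_∞` of a bounded function. -/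
def supNorm {n : ℕ} (u : EuclideanSpace ℝ (Fin n) → ℝ) : ℝ := ⨆ x, |u x|

/-- The inf-convolution `u_h (x) = inf_y (u y + |x - y|² / (2h))`. -/
def infConv {n : ℕ} (h : ℝ) (u : EuclideanSpace ℝ (Fin n) → ℝ)
    (x : EuclideanSpace ℝ (Fin n)) : ℝ :=
  ⨅ y, (u y + 1 / (2 * h) * ‖x - y‖ ^ 2)

/-- `φ ∈ C_0^∞(B_1)`, `φ ≥ 0`, `‖φ‖_1 = 1`. -/
structure IsMollifier {n : ℕ} (φ : EuclideanSpace ℝ (Fin n) → ℝ) : Prop where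
  smooth : ContDiff ℝ ∞ φ
  compact : HasCompactSupport φ
  support : tsupport φ ⊆ Metric.ball 0 1
  nonneg : ∀ x, 0 ≤ φ x
  integral_eq : ∫ x, φ x = 1

/-- The standard mollification `w * (ε^{-n} φ(ε^{-1} ·))`. -/
def mollify {n : ℕ} (φ : EuclideanSpace ℝ (Fin n) → ℝ) (ε : ℝ)
    (w : EuclideanSpace ℝ (Fin n) → ℝ) : EuclideanSpace ℝ (Fin n) → ℝ :=
  MeasureTheory.convolution w (fun z => (ε ^ n)⁻¹ * φ (ε⁻¹ • z))
    (ContinuousLinearMap.mul ℝ ℝ) MeasureTheory.volume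

end

end NonlocalInfConv

namespace NonlocalInfConv

open MeasureTheory Metric Set

section

variable {n : ℕ}

/-! An inf-convolution is an infimum of paraboloids of opening `h⁻¹`, hence semiconcave:
`secondDiff_infConv_le` gives `δ(u_h, x, y) ≤ h⁻¹|y|²` at every point. Together with boundedness,
`δ(u_h, x, y) ≤ a min(|y|², 1)` with `a = max h⁻¹ (4‖u‖_∞)`. For `0 < σ < 2` this weight is
integrable against the kernel, so only the negative part of `δ` can spoil the convergence of `D^σ
u_h`.

The negative part is controlled by duality, without any pointwise second-order differentiability.
Since `|δ| ≤ 2 a min(|y|², 1) - δ`, integrating against a cutoff `η ≥ 0` leaves `∫ η δ(u_h, ·, y) =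
∫ u_h δ(η, ·, y)`, which is `O(min(|y|², 1))` because `η` is `C²` with compact support. Hence `η(x)`
times the Hessian integrand is integrable in `(x, y)` jointly (`integrable_mul_hessianIntegrand`).
Fubini then gives (i), the local integrability of `D^σ u_h`, and, with the mollifier as cutoff, `D^σ
u_{h,ε} = (D^σ u_h) * φ_ε` everywhere.

For (iii), averaging preserves the upper bound on `δ`, and ellipticity bounds the matrices, which
yields the one-sided estimate. The a.e. limit is Lebesgue differentiation of `D^σ u_h`, followed by
continuity of the infimum of uniformly bounded linear functionals.

For (ii), a test function touching `u_h` from below at `x` is translated to a minimizer `z` of the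
inf-convolution and lowered by the penalty. It then touches `u` at `z`, and translation invariance
carries the inequality back to `x`. -/

theorem abs_le_supNorm {u : EuclideanSpace ℝ (Fin n) → ℝ} (hu : ∃ K : ℝ, ∀ x, |u x| ≤ K)
    (x : EuclideanSpace ℝ (Fin n)) : |u x| ≤ supNorm u := by
  obtain ⟨K, hK⟩ := hu
  exact le_ciSup (f := fun x => |u x|) ⟨K, by rintro _ ⟨y, rfl⟩; exact hK y⟩ x

/-! ### Inf-convolutions -/

theorem infConv_le {h K : ℝ} {u : EuclideanSpace ℝ (Fin n) → ℝ} (hh : 0 < h)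
    (hK : ∀ x, |u x| ≤ K) (x y : EuclideanSpace ℝ (Fin n)) :
    infConv h u x ≤ u y + 1 / (2 * h) * ‖x - y‖ ^ 2 := by
  refine ciInf_le ⟨-K, ?_⟩ y
  rintro _ ⟨z, rfl⟩
  have h1 : 0 ≤ 1 / (2 * h) * ‖x - z‖ ^ 2 := by positivity
  have h2 := (abs_le.1 (hK z)).1
  dsimp only
  linarith

theorem abs_infConv_le {h K : ℝ} {u : EuclideanSpace ℝ (Fin n) → ℝ} (hh : 0 < h)
    (hK : ∀ x, |u x| ≤ K) (x : EuclideanSpace ℝ (Fin n)) : |infConv h u x| ≤ K := by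
  refine abs_le.2 ⟨le_ciInf fun z => ?_, ?_⟩
  · have h1 : 0 ≤ 1 / (2 * h) * ‖x - z‖ ^ 2 := by positivity
    have h2 := (abs_le.1 (hK z)).1
    linarith
  · have := infConv_le hh hK x x
    simp only [sub_self, norm_zero] at this
    have h2 := (abs_le.1 (hK x)).2
    linarith

/-- The infimum in the inf-convolution is attained, at distance at most `2 √(h K)`. -/
theorem exists_infConv_eq {h K : ℝ} {u : EuclideanSpace ℝ (Fin n) → ℝ} (hh : 0 < h)
    (hu : LowerSemicontinuous u) (hK : ∀ x, |u x| ≤ K) (x : EuclideanSpace ℝ (Fin n)) :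
    ∃ y, ‖x - y‖ ≤ 2 * √(h * K) ∧ infConv h u x = u y + 1 / (2 * h) * ‖x - y‖ ^ 2 := by
  have hK0 : 0 ≤ K := (abs_nonneg _).trans (hK x)
  have hlsc : LowerSemicontinuousOn (fun y => u y + 1 / (2 * h) * ‖x - y‖ ^ 2)
      (closedBall x (2 * √(h * K))) :=
    ((hu.add (Continuous.lowerSemicontinuous (by fun_prop))).lowerSemicontinuousOn _)
  obtain ⟨y, hy, hmin⟩ := LowerSemicontinuousOn.exists_isMinOn
    ⟨x, mem_closedBall_self (by positivity)⟩ (isCompact_closedBall x (2 * √(h * K))) hlsc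
  refine ⟨y, by rwa [← dist_eq_norm, dist_comm], le_antisymm (infConv_le hh hK x y) ?_⟩
  refine le_ciInf fun z => ?_
  by_cases hz : z ∈ closedBall x (2 * √(h * K))
  · exact hmin hz
  · have h1 : u y + 1 / (2 * h) * ‖x - y‖ ^ 2 ≤ u x + 1 / (2 * h) * ‖x - x‖ ^ 2 :=
      hmin (mem_closedBall_self (by positivity))
    have h2 : 2 * √(h * K) < ‖x - z‖ := by
      rw [← dist_eq_norm, dist_comm]
      simpa using hz
    have h3 : 4 * (h * K) ≤ ‖x - z‖ ^ 2 := by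
      have := pow_le_pow_left₀ (by positivity) h2.le 2
      rw [mul_pow, Real.sq_sqrt (by positivity)] at this
      linarith
    -- The radius `2√(hK)` is chosen for this: outside the ball the penalty is at least `2K ≥ u x -
    -- u z`, so no such `z` beats the competitor `x`.
    have h4 : 2 * K ≤ 1 / (2 * h) * ‖x - z‖ ^ 2 := by
      calc 2 * K = 1 / (2 * h) * (4 * (h * K)) := by field_simp; ring
        _ ≤ _ := by gcongr
    have h5 := (abs_le.1 (hK z)).1
    have h6 := (abs_le.1 (hK x)).2
    simp only [sub_self, norm_zero] at h1
    linarith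

/-- A minimizer for `x'` is a competitor for `x`, and it lies within `2√(hK)` of `x'`. The change of
penalty is therefore controlled by `‖x - x'‖`, uniformly in the base point. -/
theorem continuous_infConv {h K : ℝ} {u : EuclideanSpace ℝ (Fin n) → ℝ} (hh : 0 < h)
    (hu : LowerSemicontinuous u) (hK : ∀ x, |u x| ≤ K) : Continuous (infConv h u) := by
  have key : ∀ x x', infConv h u x - infConv h u x' ≤
      1 / (2 * h) * (‖x - x'‖ * (‖x - x'‖ + 2 * (2 * √(h * K)))) := by
    intro x x'
    obtain ⟨y, hy, he⟩ := exists_infConv_eq hh hu hK x'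
    have h1 := infConv_le hh hK x y
    have h2 : ‖x - y‖ ≤ ‖x - x'‖ + ‖x' - y‖ := norm_sub_le_norm_sub_add_norm_sub _ _ _
    have h3 : ‖x - y‖ ^ 2 ≤ ‖x' - y‖ ^ 2 + ‖x - x'‖ * (‖x - x'‖ + 2 * (2 * √(h * K))) := by
      nlinarith [norm_nonneg (x - x'), norm_nonneg (x' - y), norm_nonneg (x - y)]
    have h4 : 1 / (2 * h) * ‖x - y‖ ^ 2 ≤ 1 / (2 * h) *
        (‖x' - y‖ ^ 2 + ‖x - x'‖ * (‖x - x'‖ + 2 * (2 * √(h * K)))) := by gcongr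
    rw [he]
    linarith
  refine continuous_iff_continuousAt.2 fun x => ?_
  rw [ContinuousAt, tendsto_iff_dist_tendsto_zero]
  have hlim : Filter.Tendsto (fun x' => 1 / (2 * h) *
      (‖x' - x‖ * (‖x' - x‖ + 2 * (2 * √(h * K))))) (𝓝 x) (𝓝 0) := by
    have : Continuous fun x' => 1 / (2 * h) * (‖x' - x‖ * (‖x' - x‖ + 2 * (2 * √(h * K)))) := by
      fun_prop
    simpa using this.tendsto x
  refine squeeze_zero (fun _ => dist_nonneg) (fun x' => ?_) hlim
  rw [Real.dist_eq, abs_le]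
  have h1 := key x x'
  rw [norm_sub_rev] at h1
  exact ⟨by linarith, key x' x⟩

/-- By the parallelogram law each paraboloid in the infimum has second difference exactly `h⁻¹‖y‖²`,
and taking an infimum preserves an upper bound on second differences. -/
theorem secondDiff_infConv_le {h K : ℝ} {u : EuclideanSpace ℝ (Fin n) → ℝ} (hh : 0 < h)
    (hK : ∀ x, |u x| ≤ K) (x y : EuclideanSpace ℝ (Fin n)) :
    secondDiff (infConv h u) x y ≤ h⁻¹ * ‖y‖ ^ 2 := by
  have : (infConv h u (x + y) + infConv h u (x - y) - h⁻¹ * ‖y‖ ^ 2) / 2 ≤ infConv h u x := by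
    refine le_ciInf fun z => ?_
    have h1 := infConv_le hh hK (x + y) z
    have h2 := infConv_le hh hK (x - y) z
    have h3 := parallelogram_law_with_norm ℝ (x - z) y
    rw [show x - z + y = x + y - z by abel, show x - z - y = x - y - z by abel] at h3
    have h4 : 1 / (2 * h) * ‖x + y - z‖ ^ 2 + 1 / (2 * h) * ‖x - y - z‖ ^ 2 =
        2 * (1 / (2 * h) * ‖x - z‖ ^ 2) + h⁻¹ * ‖y‖ ^ 2 := by
      rw [← mul_add, h3]; field_simp
    linarith
  rw [secondDiff]
  linarith

/-! ### Second differences -/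

theorem abs_secondDiff_le_of_abs_le {K : ℝ} {u : EuclideanSpace ℝ (Fin n) → ℝ}
    (hK : ∀ x, |u x| ≤ K) (x y : EuclideanSpace ℝ (Fin n)) : |secondDiff u x y| ≤ 4 * K := by
  have h1 := abs_le.1 (hK (x + y))
  have h2 := abs_le.1 (hK (x - y))
  have h3 := abs_le.1 (hK x)
  rw [secondDiff, abs_le]
  constructor <;> linarith

/-- Combines the quadratic bound near the origin with the trivial one far away, in the form that is
integrable against the kernel. -/
theorem secondDiff_le_min {a K : ℝ} {u : EuclideanSpace ℝ (Fin n) → ℝ}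
    (hK : ∀ x, |u x| ≤ K) (x y : EuclideanSpace ℝ (Fin n))
    (ha : secondDiff u x y ≤ a * ‖y‖ ^ 2) :
    secondDiff u x y ≤ max a (4 * K) * min (‖y‖ ^ 2) 1 := by
  rcases le_total (‖y‖ ^ 2) 1 with h | h
  · rw [min_eq_left h]
    exact ha.trans (by gcongr; exact le_max_left _ _)
  · rw [min_eq_right h, mul_one]
    exact ((le_abs_self _).trans (abs_secondDiff_le_of_abs_le hK x y)).trans (le_max_right _ _)

/-- Mean value inequality on `closedBall 0 ‖y‖` for `z ↦ u (x + z) + u (x - z)`, whose derivative is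
a difference of gradients at distance `2‖z‖`. -/
theorem abs_secondDiff_le_of_lipschitz {u : EuclideanSpace ℝ (Fin n) → ℝ}
    {x : EuclideanSpace ℝ (Fin n)} {r : ℝ} {L : NNReal}
    (hd : ∀ z ∈ ball x r, DifferentiableAt ℝ u z) (hL : LipschitzOnWith L (fderiv ℝ u) (ball x r))
    {y : EuclideanSpace ℝ (Fin n)} (hy : ‖y‖ < r) :
    |secondDiff u x y| ≤ 2 * L * ‖y‖ ^ 2 := by
  have hmem : ∀ z ∈ closedBall (0 : EuclideanSpace ℝ (Fin n)) ‖y‖,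
      x + z ∈ ball x r ∧ x - z ∈ ball x r := by
    intro z hz
    have : ‖z‖ < r := (mem_closedBall_zero_iff.1 hz).trans_lt hy
    simpa [mem_ball, dist_eq_norm] using this
  have hder : ∀ z ∈ closedBall (0 : EuclideanSpace ℝ (Fin n)) ‖y‖,
      HasFDerivWithinAt (fun z => u (x + z) + u (x - z))
        (fderiv ℝ u (x + z) - fderiv ℝ u (x - z)) (closedBall 0 ‖y‖) z := by
    intro z hz
    have h1 := (hd _ (hmem z hz).1).hasFDerivAt.comp z ((hasFDerivAt_id z).const_add x)
    have h2 := (hd _ (hmem z hz).2).hasFDerivAt.comp z ((hasFDerivAt_id z).const_sub x)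
    refine (h1.add h2).hasFDerivWithinAt.congr_fderiv ?_
    ext w
    simp [sub_eq_add_neg]
  have hbd : ∀ z ∈ closedBall (0 : EuclideanSpace ℝ (Fin n)) ‖y‖,
      ‖fderiv ℝ u (x + z) - fderiv ℝ u (x - z)‖ ≤ 2 * L * ‖y‖ := by
    intro z hz
    have h1 := hL.dist_le_mul _ (hmem z hz).1 _ (hmem z hz).2
    rw [dist_eq_norm, dist_eq_norm, show x + z - (x - z) = (2 : ℝ) • z by rw [two_smul]; abel,
      norm_smul] at h1
    have h2 : ‖z‖ ≤ ‖y‖ := mem_closedBall_zero_iff.1 hz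
    calc _ ≤ (L : ℝ) * (‖(2 : ℝ)‖ * ‖z‖) := h1
      _ ≤ (L : ℝ) * (‖(2 : ℝ)‖ * ‖y‖) := by gcongr
      _ = _ := by simp; ring
  have := Convex.norm_image_sub_le_of_norm_hasFDerivWithin_le hder hbd
    (convex_closedBall (0 : EuclideanSpace ℝ (Fin n)) ‖y‖)
    (mem_closedBall_self (norm_nonneg y)) (mem_closedBall_zero_iff.2 le_rfl)
  simp only [add_zero, sub_zero, Real.norm_eq_abs] at this
  rw [secondDiff, two_mul, pow_two, ← mul_assoc]
  exact this

theorem exists_abs_secondDiff_le_of_contDiffAt {u : EuclideanSpace ℝ (Fin n) → ℝ}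
    {x : EuclideanSpace ℝ (Fin n)} (hu : ContDiffAt ℝ 2 u x) :
    ∃ r > 0, ∃ L : ℝ, ∀ y, ‖y‖ < r → |secondDiff u x y| ≤ L * ‖y‖ ^ 2 := by
  obtain ⟨L, s, hs, hL⟩ := (hu.fderiv_right (m := 1) le_rfl).exists_lipschitzOnWith
  have h2 : ∀ᶠ z in 𝓝 x, DifferentiableAt ℝ u z := by
    filter_upwards [hu.eventually (by simp)] with z hz using hz.differentiableAt (by simp)
  obtain ⟨r, hr, hsub⟩ := Metric.mem_nhds_iff.1 (Filter.inter_mem hs h2)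
  exact ⟨r, hr, 2 * L, fun y hy => abs_secondDiff_le_of_lipschitz
    (fun z hz => (hsub hz).2) (hL.mono fun z hz => (hsub hz).1) hy⟩

theorem exists_abs_secondDiff_le_of_hasCompactSupport {u : EuclideanSpace ℝ (Fin n) → ℝ}
    (hu : ContDiff ℝ 2 u) (hc : HasCompactSupport u) :
    ∃ L : ℝ, 0 ≤ L ∧ ∀ x y, |secondDiff u x y| ≤ L * ‖y‖ ^ 2 := by
  obtain ⟨L, hL⟩ := ContDiff.lipschitzWith_of_hasCompactSupport (hc.fderiv (𝕜 := ℝ))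
    (hu.fderiv_right (m := 1) le_rfl) (by simp)
  exact ⟨2 * L, by positivity, fun x y => abs_secondDiff_le_of_lipschitz (r := ‖y‖ + 1)
    (fun z _ => hu.differentiable (by simp) z) (hL.lipschitzOnWith) (by linarith)⟩

/-! ### The kernel -/

/-- In polar coordinates the radial density is `r^(1-σ)` on `(0, 1]`, integrable as `σ < 2`, and
`r^(-1-σ)` beyond, integrable as `σ > 0`. -/
theorem integrable_min_mul_kernel (hn : n ≠ 0) {σ : ℝ} (hσ0 : 0 < σ) (hσ2 : σ < 2) :
    Integrable fun y : EuclideanSpace ℝ (Fin n) =>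
      min (‖y‖ ^ 2) 1 * (‖y‖ ^ 2 / ‖y‖ ^ ((n : ℝ) + 2 + σ)) := by
  have : NeZero n := ⟨hn⟩
  rw [integrable_fun_norm_addHaar volume
    (f := fun r : ℝ => min (r ^ 2) 1 * (r ^ 2 / r ^ ((n : ℝ) + 2 + σ)))]
  have hr : ∀ r : ℝ, 0 < r → r ^ (n - 1) * (r ^ 2 / r ^ ((n : ℝ) + 2 + σ)) = r ^ (-1 - σ) := by
    intro r hr
    have h1 : ((n - 1 : ℕ) : ℝ) = n - 1 := by
      rw [Nat.cast_sub (Nat.one_le_iff_ne_zero.2 hn)]; simp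
    rw [← Real.rpow_natCast, ← Real.rpow_natCast, ← Real.rpow_sub hr, ← Real.rpow_add hr, h1]
    congr 1
    push_cast
    ring
  rw [finrank_euclideanSpace_fin, ← Ioc_union_Ioi_eq_Ioi zero_le_one]
  refine IntegrableOn.union ?_ ?_
  · have h1 : IntegrableOn (fun r : ℝ => r ^ (1 - σ)) (Ioc 0 1) := by
      rw [← intervalIntegrable_iff_integrableOn_Ioc_of_le zero_le_one]
      exact intervalIntegral.intervalIntegrable_rpow' (by linarith)
    refine h1.congr_fun (fun r hr' => ?_) measurableSet_Ioc
    have h2 : r ^ 2 ≤ 1 := pow_le_one₀ hr'.1.le hr'.2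
    dsimp only
    rw [min_eq_left h2, smul_eq_mul, mul_left_comm, hr r hr'.1, ← Real.rpow_natCast,
      ← Real.rpow_add hr'.1]
    congr 1
    push_cast
    ring
  · refine (integrableOn_Ioi_rpow_of_lt (show -1 - σ < -1 by linarith) one_pos).congr_fun
      (fun r hr' => ?_) measurableSet_Ioi
    have h0 : (1 : ℝ) < r := hr'
    dsimp only
    rw [min_eq_right (one_le_pow₀ h0.le), one_mul, smul_eq_mul, hr r (by linarith)]

theorem abs_apply_mul_apply_le (y : EuclideanSpace ℝ (Fin n)) (i j : Fin n) :
    |y i * y j| ≤ ‖y‖ ^ 2 := by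
  rw [abs_mul, pow_two]
  exact mul_le_mul (PiLp.norm_apply_le y i) (PiLp.norm_apply_le y j) (abs_nonneg _) (norm_nonneg _)

theorem abs_hessianIntegrand_le {σ : ℝ} (u : EuclideanSpace ℝ (Fin n) → ℝ)
    (x : EuclideanSpace ℝ (Fin n)) (i j : Fin n) (y : EuclideanSpace ℝ (Fin n)) :
    |hessianIntegrand σ u x i j y| ≤
      |secondDiff u x y| * (‖y‖ ^ 2 / ‖y‖ ^ ((n : ℝ) + 2 + σ)) := by
  have h0 : 0 ≤ ‖y‖ ^ ((n : ℝ) + 2 + σ) := by positivity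
  rw [hessianIntegrand, abs_div, abs_mul, abs_of_nonneg h0, mul_div_assoc]
  gcongr
  exact abs_apply_mul_apply_le y i j

theorem measurable_secondDiff {u : EuclideanSpace ℝ (Fin n) → ℝ} (hu : Measurable u)
    (x : EuclideanSpace ℝ (Fin n)) : Measurable (secondDiff u x) := by
  unfold secondDiff
  fun_prop

theorem measurable_hessianIntegrand {σ : ℝ} {u : EuclideanSpace ℝ (Fin n) → ℝ} (hu : Measurable u)
    (x : EuclideanSpace ℝ (Fin n)) (i j : Fin n) : Measurable (hessianIntegrand σ u x i j) := by
  unfold hessianIntegrand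
  have := measurable_secondDiff hu x
  fun_prop

theorem integrable_hessianIntegrand_of_contDiffAt (hn : n ≠ 0) {σ : ℝ} (hσ0 : 0 < σ) (hσ2 : σ < 2)
    {K : ℝ} {u v : EuclideanSpace ℝ (Fin n) → ℝ} {x : EuclideanSpace ℝ (Fin n)} (hu : Measurable u)
    (hK : ∀ x, |u x| ≤ K) (hv : ContDiffAt ℝ 2 v x) (huv : u =ᶠ[𝓝 x] v) (i j : Fin n) :
    Integrable (hessianIntegrand σ u x i j) := by
  obtain ⟨r, hr, L, hL⟩ := exists_abs_secondDiff_le_of_contDiffAt (hv.congr_of_eventuallyEq huv)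
  have hK0 : 0 ≤ K := (abs_nonneg _).trans (hK x)
  -- Capping at `1` ensures `min (‖y‖²) 1 ≥ s²` once `‖y‖ ≥ s`, so there the bound `4K` is absorbed
  -- by `4K / s²`.
  set s := min r 1 with hs
  have hs0 : 0 < s := lt_min hr one_pos
  have hb : ∀ y, |secondDiff u x y| ≤ (max L 0 + 4 * K / s ^ 2) * min (‖y‖ ^ 2) 1 := by
    intro y
    have hM : 0 ≤ 4 * K / s ^ 2 := by positivity
    rcases lt_or_ge ‖y‖ s with h | h
    · have h1 : ‖y‖ ^ 2 ≤ 1 := pow_le_one₀ (norm_nonneg _) (h.le.trans (min_le_right _ _))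
      rw [min_eq_left h1]
      refine (hL y (h.trans_le (min_le_left _ _))).trans ?_
      gcongr
      exact (le_max_left _ _).trans (by linarith)
    · have h1 : s ^ 2 ≤ min (‖y‖ ^ 2) 1 :=
        le_min (by gcongr) (pow_le_one₀ hs0.le (min_le_right _ _))
      calc |secondDiff u x y| ≤ 4 * K := abs_secondDiff_le_of_abs_le hK x y
        _ = 4 * K / s ^ 2 * s ^ 2 := by field_simp
        _ ≤ _ := by
          gcongr
          exact le_add_of_nonneg_left (le_max_right _ _)
  refine ((integrable_min_mul_kernel hn hσ0 hσ2).const_mul (max L 0 + 4 * K / s ^ 2)).mono'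
    (measurable_hessianIntegrand hu x i j).aestronglyMeasurable (ae_of_all _ fun y => ?_)
  refine (abs_hessianIntegrand_le u x i j y).trans ?_
  rw [← mul_assoc]
  gcongr
  exact hb y

/-! ### Elliptic matrices -/

theorem dotProduct_self_eq_norm_sq (y : EuclideanSpace ℝ (Fin n)) :
    ∑ i, y i * y i = ‖y‖ ^ 2 := by
  simp [EuclideanSpace.norm_sq_eq, ← pow_two]

theorem quadForm_nonneg {A : Matrix (Fin n) (Fin n) ℝ} (hA : A.PosSemidef) (y : Fin n → ℝ) :
    0 ≤ ∑ i, ∑ j, A i j * (y i * y j) := by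
  have := hA.dotProduct_mulVec_nonneg y
  simp only [dotProduct, Matrix.mulVec, Finset.mul_sum, star_trivial] at this
  refine this.trans_eq (Finset.sum_congr rfl fun i _ => Finset.sum_congr rfl fun j _ => ?_)
  ring

/-- The upper ellipticity bound reads `σ A + Tr(A) Id ≤ (n + σ) Λ Id`; since `A ≥ O`, the trace term
is nonnegative and can be dropped. -/
theorem quadForm_le {σ lam Lam : ℝ} (hσ : 0 < σ) {A : Matrix (Fin n) (Fin n) ℝ}
    (hA : A ∈ ellipticSet n σ lam Lam) (y : Fin n → ℝ) :
    ∑ i, ∑ j, A i j * (y i * y j) ≤ (n + σ) * Lam / σ * ∑ i, y i * y i := by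
  obtain ⟨h0, -, h1⟩ := hA
  have h2 := quadForm_nonneg h1 y
  have h3 : 0 ≤ A.trace := h0.trace_nonneg
  have h4 : 0 ≤ ∑ i, y i * y i := Finset.sum_nonneg fun i _ => mul_self_nonneg _
  have hdiag : ∀ c : ℝ, ∑ i, ∑ j, c * (1 : Matrix (Fin n) (Fin n) ℝ) i j * (y i * y j) =
      c * ∑ i, y i * y i := by
    intro c
    rw [Finset.mul_sum]
    refine Finset.sum_congr rfl fun i _ => ?_
    rw [Finset.sum_eq_single i (fun j _ hj => by simp [Matrix.one_apply_ne' hj]) (by simp)]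
    simp
  have h5 : ∑ i, ∑ j, (Lam • (1 : Matrix (Fin n) (Fin n) ℝ) - sigmaMatrix σ A) i j * (y i * y j) =
      Lam * (∑ i, y i * y i) - ((n : ℝ) + σ)⁻¹ *
        (σ * ∑ i, ∑ j, A i j * (y i * y j) + A.trace * ∑ i, y i * y i) := by
    rw [← hdiag, ← hdiag, Finset.mul_sum, ← Finset.sum_add_distrib, Finset.mul_sum,
      ← Finset.sum_sub_distrib]
    refine Finset.sum_congr rfl fun i _ => ?_
    rw [Finset.mul_sum, ← Finset.sum_add_distrib, Finset.mul_sum, ← Finset.sum_sub_distrib]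
    refine Finset.sum_congr rfl fun j _ => ?_
    simp only [sigmaMatrix, Matrix.sub_apply, Matrix.smul_apply, Matrix.add_apply, smul_eq_mul]
    ring
  have hpos : 0 < (n : ℝ) + σ := by positivity
  rw [h5, sub_nonneg, inv_mul_le_iff₀ hpos] at h2
  rw [div_mul_eq_mul_div, le_div_iff₀ hσ]
  nlinarith [mul_nonneg h3 h4]

theorem abs_entry_le {σ lam Lam : ℝ} (hσ : 0 < σ) {A : Matrix (Fin n) (Fin n) ℝ}
    (hA : A ∈ ellipticSet n σ lam Lam) (i j : Fin n) : |A i j| ≤ (n + σ) * Lam / σ := by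
  -- Testing on `e_i + s e_j` with `s = ±1` bounds the off-diagonal entry by the mean of two
  -- diagonal ones.
  have hq : ∀ s : ℝ, ∑ k, ∑ l, A k l * ((Pi.single i 1 + s • Pi.single j 1 : Fin n → ℝ) k *
      (Pi.single i 1 + s • Pi.single j 1 : Fin n → ℝ) l) =
      A i i + s * A i j + s * A j i + s ^ 2 * A j j := by
    intro s
    have : ∀ k l, A k l * ((Pi.single i 1 + s • Pi.single j 1 : Fin n → ℝ) k *
      (Pi.single i 1 + s • Pi.single j 1 : Fin n → ℝ) l) =
      (if k = i then (if l = i then A k l else 0) else 0) +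
      (if k = i then (if l = j then s * A k l else 0) else 0) +
      (if k = j then (if l = i then s * A k l else 0) else 0) +
      (if k = j then (if l = j then s ^ 2 * A k l else 0) else 0) := by
      intro k l
      simp only [Pi.add_apply, Pi.smul_apply, Pi.single_apply, smul_eq_mul]
      split_ifs <;> ring
    simp only [this, Finset.sum_add_distrib]
    simp
  have hdiag : ∀ k, A k k ≤ (n + σ) * Lam / σ := by
    intro k
    have := quadForm_le hσ hA (Pi.single k 1)
    simpa [Pi.single_apply] using this
  have hsymm : A j i = A i j := by
    have := hA.1.isHermitian.apply i j
    simpa using this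
  have h1 := (hq 1) ▸ quadForm_nonneg hA.1 _
  have h2 := (hq (-1)) ▸ quadForm_nonneg hA.1 _
  have h3 := hdiag i
  have h4 := hdiag j
  rw [hsymm] at h1 h2
  rw [abs_le]
  constructor <;> linarith

theorem abs_trace_mul_le {M : ℝ} {A D : Matrix (Fin n) (Fin n) ℝ} (hA : ∀ i j, |A i j| ≤ M) :
    |(A * D).trace| ≤ M * ∑ i, ∑ j, |D j i| := by
  simp only [Matrix.trace, Matrix.diag, Matrix.mul_apply, Finset.mul_sum]
  refine (Finset.abs_sum_le_sum_abs _ _).trans (Finset.sum_le_sum fun i _ => ?_)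
  refine (Finset.abs_sum_le_sum_abs _ _).trans (Finset.sum_le_sum fun j _ => ?_)
  rw [abs_mul]
  gcongr
  exact hA i j

theorem bddBelow_trace_mul {B : Type*} {M : ℝ} {A : B → Matrix (Fin n) (Fin n) ℝ}
    (hA : ∀ β i j, |A β i j| ≤ M) (D : Matrix (Fin n) (Fin n) ℝ) :
    BddBelow (range fun β => (A β * D).trace) := by
  refine ⟨-(M * ∑ i, ∑ j, |D j i|), ?_⟩
  rintro _ ⟨β, rfl⟩
  exact neg_le_of_abs_le (abs_trace_mul_le (hA β))

/-- An infimum of linear functionals with a common bound is Lipschitz in the matrix, with a constant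
independent of `β`. -/
theorem tendsto_iInf_trace_mul {B ι : Type*} [Nonempty B] {M : ℝ}
    {A : B → Matrix (Fin n) (Fin n) ℝ} (hA : ∀ β i j, |A β i j| ≤ M) {l : Filter ι}
    {D : ι → Matrix (Fin n) (Fin n) ℝ} {D₀ : Matrix (Fin n) (Fin n) ℝ}
    (hD : ∀ i j, Filter.Tendsto (fun k => D k i j) l (𝓝 (D₀ i j))) :
    Filter.Tendsto (fun k => ⨅ β, (A β * D k).trace) l (𝓝 (⨅ β, (A β * D₀).trace)) := by
  have key : ∀ P Q : Matrix (Fin n) (Fin n) ℝ, (⨅ β, (A β * P).trace) - ⨅ β, (A β * Q).trace ≤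
      M * ∑ i, ∑ j, |P j i - Q j i| := by
    intro P Q
    rw [sub_le_comm]
    refine le_ciInf fun β => ?_
    have h1 := ciInf_le (bddBelow_trace_mul hA P) β
    have h2 := (le_abs_self _).trans (abs_trace_mul_le (hA β) (D := P - Q))
    rw [Matrix.mul_sub, Matrix.trace_sub] at h2
    simp only [Matrix.sub_apply] at h2
    linarith
  rw [tendsto_iff_dist_tendsto_zero]
  have hlim : Filter.Tendsto (fun k => M * ∑ i, ∑ j, |D k j i - D₀ j i|) l (𝓝 0) := by
    have : Filter.Tendsto (fun k => M * ∑ i, ∑ j, |D k j i - D₀ j i|) l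
        (𝓝 (M * ∑ i : Fin n, ∑ j : Fin n, |D₀ j i - D₀ j i|)) :=
      (tendsto_finsetSum _ fun i _ => tendsto_finsetSum _ fun j _ =>
        ((hD j i).sub_const _).abs).const_mul _
    simpa using this
  refine squeeze_zero (fun _ => dist_nonneg) (fun k => ?_) hlim
  rw [Real.dist_eq, abs_le]
  have h1 := key D₀ (D k)
  simp only [abs_sub_comm (D₀ _ _)] at h1
  exact ⟨by linarith, key (D k) D₀⟩

/-- Writes the trace as one integral of `δ` against a scalar kernel. For `A ≥ O` that kernel is
nonnegative, so pointwise bounds on `δ` pass to the operator. -/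
theorem trace_mul_fracHessian {σ : ℝ} (A : Matrix (Fin n) (Fin n) ℝ)
    {u : EuclideanSpace ℝ (Fin n) → ℝ} {x : EuclideanSpace ℝ (Fin n)}
    (hu : ∀ i j, Integrable (hessianIntegrand σ u x i j)) :
    Integrable (fun y => secondDiff u x y * ((∑ i, ∑ j, A i j * (y i * y j)) /
      ‖y‖ ^ ((n : ℝ) + 2 + σ))) ∧
    (A * fracHessian σ u x).trace = normConst n σ / 2 *
      ∫ y, secondDiff u x y * ((∑ i, ∑ j, A i j * (y i * y j)) / ‖y‖ ^ ((n : ℝ) + 2 + σ)) := by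
  have h : (fun y => secondDiff u x y * ((∑ i, ∑ j, A i j * (y i * y j)) /
      ‖y‖ ^ ((n : ℝ) + 2 + σ))) =
      fun y => ∑ i, ∑ j, A i j * hessianIntegrand σ u x j i y := by
    ext y
    rw [Finset.sum_div, Finset.mul_sum]
    refine Finset.sum_congr rfl fun i _ => ?_
    rw [Finset.sum_div, Finset.mul_sum]
    refine Finset.sum_congr rfl fun j _ => ?_
    rw [hessianIntegrand]
    ring
  rw [h]
  refine ⟨integrable_finsetSum _ fun i _ => integrable_finsetSum _ fun j _ =>
    (hu j i).const_mul _, ?_⟩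
  have hsum : ∫ y, ∑ i, ∑ j, A i j * hessianIntegrand σ u x j i y =
      ∑ i, ∑ j, A i j * ∫ y, hessianIntegrand σ u x j i y := by
    rw [integral_finsetSum _
      (fun i _ => integrable_finsetSum _ fun j _ => (hu j i).const_mul (A i j))]
    refine Finset.sum_congr rfl fun i _ => ?_
    rw [integral_finsetSum _ (fun j _ => (hu j i).const_mul (A i j))]
    exact Finset.sum_congr rfl fun j _ => integral_const_mul _ _
  rw [hsum]
  simp only [Matrix.trace, Matrix.diag, Matrix.mul_apply, Finset.mul_sum, fracHessian,
    Matrix.of_apply]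
  exact Finset.sum_congr rfl fun i _ => Finset.sum_congr rfl fun j _ => mul_left_comm _ _ _

theorem normConst_nonneg {σ : ℝ} (hσ : 0 < σ) : 0 ≤ normConst n σ := by
  have : 0 < Real.Gamma ((n + σ) / 2) := Real.Gamma_pos_of_pos (by positivity)
  unfold normConst
  positivity

theorem trace_mul_fracHessian_mono {σ : ℝ} (hσ : 0 < σ) {A : Matrix (Fin n) (Fin n) ℝ}
    (hA : A.PosSemidef) {u v : EuclideanSpace ℝ (Fin n) → ℝ} {x z : EuclideanSpace ℝ (Fin n)}
    (hu : ∀ i j, Integrable (hessianIntegrand σ u x i j))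
    (hv : ∀ i j, Integrable (hessianIntegrand σ v z i j))
    (huv : ∀ y, secondDiff u x y ≤ secondDiff v z y) :
    (A * fracHessian σ u x).trace ≤ (A * fracHessian σ v z).trace := by
  obtain ⟨h1, h2⟩ := trace_mul_fracHessian A hu
  obtain ⟨h3, h4⟩ := trace_mul_fracHessian A hv
  rw [h2, h4]
  refine mul_le_mul_of_nonneg_left (integral_mono h1 h3 fun y => ?_)
    (div_nonneg (normConst_nonneg hσ) zero_le_two)
  exact mul_le_mul_of_nonneg_right (huv y)
    (div_nonneg (quadForm_nonneg hA _) (by positivity))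

theorem trace_mul_fracHessian_le (hn : n ≠ 0) {σ lam Lam : ℝ} (hσ0 : 0 < σ) (hσ2 : σ < 2)
    {A : Matrix (Fin n) (Fin n) ℝ} (hA : A ∈ ellipticSet n σ lam Lam)
    {u : EuclideanSpace ℝ (Fin n) → ℝ} {x : EuclideanSpace ℝ (Fin n)}
    (hu : ∀ i j, Integrable (hessianIntegrand σ u x i j)) {a : ℝ} (ha : 0 ≤ a)
    (hδ : ∀ y, secondDiff u x y ≤ a * min (‖y‖ ^ 2) 1) :
    (A * fracHessian σ u x).trace ≤ normConst n σ / 2 * (a * ((n + σ) * Lam / σ) *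
      ∫ y : EuclideanSpace ℝ (Fin n), min (‖y‖ ^ 2) 1 * (‖y‖ ^ 2 / ‖y‖ ^ ((n : ℝ) + 2 + σ))) := by
  obtain ⟨h1, h2⟩ := trace_mul_fracHessian A hu
  rw [h2, ← integral_const_mul (a * ((n + σ) * Lam / σ))]
  refine mul_le_mul_of_nonneg_left (integral_mono h1
    ((integrable_min_mul_kernel hn hσ0 hσ2).const_mul _) fun y => ?_)
    (div_nonneg (normConst_nonneg hσ0) zero_le_two)
  have h3 := quadForm_le hσ0 hA y
  rw [dotProduct_self_eq_norm_sq] at h3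
  calc secondDiff u x y * ((∑ i, ∑ j, A i j * (y i * y j)) / ‖y‖ ^ ((n : ℝ) + 2 + σ))
      ≤ a * min (‖y‖ ^ 2) 1 *
        ((∑ i, ∑ j, A i j * (y i * y j)) / ‖y‖ ^ ((n : ℝ) + 2 + σ)) := by
        refine mul_le_mul_of_nonneg_right (hδ y)
          (div_nonneg (quadForm_nonneg hA.1 _) (by positivity))
    _ ≤ a * min (‖y‖ ^ 2) 1 *
        ((n + σ) * Lam / σ * ‖y‖ ^ 2 / ‖y‖ ^ ((n : ℝ) + 2 + σ)) := by gcongr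
    _ = _ := by ring

/-! ### Integrability of second differences of semiconcave functions -/

/-- For `‖y‖ ≤ 1` the second difference is at most `L‖y‖²` and vanishes outside a fixed ball; for
larger `y` the translation-invariant `L¹` norm of `η` suffices. -/
theorem exists_integral_abs_secondDiff_le {η : EuclideanSpace ℝ (Fin n) → ℝ}
    (hη : ContDiff ℝ 2 η) (hc : HasCompactSupport η) (h0 : ∀ x, 0 ≤ η x) :
    ∃ C : ℝ, 0 ≤ C ∧ ∀ y, ∫ x, |secondDiff η x y| ≤ C * min (‖y‖ ^ 2) 1 := by
  obtain ⟨L, hL0, hL⟩ := exists_abs_secondDiff_le_of_hasCompactSupport hη hc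
  obtain ⟨R, hR⟩ := hc.isCompact.isBounded.subset_closedBall 0
  have hint : Integrable η := hη.continuous.integrable_of_hasCompactSupport hc
  have hI : 0 ≤ ∫ x, η x := integral_nonneg h0
  set V : ℝ := volume.real (closedBall (0 : EuclideanSpace ℝ (Fin n)) (R + 1)) with hV
  have hV0 : 0 ≤ V := measureReal_nonneg
  refine ⟨L * V + 4 * ∫ x, η x, by positivity, fun y => ?_⟩
  have hi1 : Integrable fun x => η (x + y) := hint.comp_add_right y
  have hi2 : Integrable fun x => η (x - y) := hint.comp_sub_right y
  have hδ : Integrable fun x => secondDiff η x y := (hi1.add hi2).sub (hint.const_mul 2)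
  rcases le_total (‖y‖ ^ 2) 1 with h | h
  · have hy1 : ‖y‖ ≤ 1 := by nlinarith [norm_nonneg y]
    have hzero : ∀ z, R < ‖z‖ → η z = 0 := by
      intro z hz
      by_contra hne
      have := hR (subset_tsupport η hne)
      rw [mem_closedBall_zero_iff] at this
      linarith
    rw [min_eq_left h]
    calc ∫ x, |secondDiff η x y|
        ≤ ∫ x, (closedBall (0 : EuclideanSpace ℝ (Fin n)) (R + 1)).indicator
            (fun _ => L * ‖y‖ ^ 2) x := by
          refine integral_mono hδ.abs ((integrable_indicator_iff measurableSet_closedBall).2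
            (integrableOn_const measure_closedBall_lt_top.ne)) fun x => ?_
          by_cases hx : x ∈ closedBall (0 : EuclideanSpace ℝ (Fin n)) (R + 1)
          · rw [indicator_of_mem hx]
            exact hL x y
          · rw [indicator_of_notMem hx]
            rw [mem_closedBall_zero_iff, not_le] at hx
            have h1 : ‖x‖ ≤ ‖x + y‖ + ‖y‖ := by
              simpa using norm_sub_le (x + y) y
            have h2 : ‖x‖ ≤ ‖x - y‖ + ‖y‖ := by
              simpa using norm_add_le (x - y) y
            simp only [secondDiff]
            rw [hzero x (by linarith), hzero (x + y) (by linarith), hzero (x - y) (by linarith)]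
            simp
      _ = L * V * ‖y‖ ^ 2 := by
          rw [integral_indicator_const _ measurableSet_closedBall, smul_eq_mul]
          ring
      _ ≤ _ := by
          gcongr
          linarith
  · rw [min_eq_right h, mul_one]
    calc ∫ x, |secondDiff η x y| ≤ ∫ x, (η (x + y) + η (x - y) + 2 * η x) := by
          refine integral_mono hδ.abs ((hi1.add hi2).add (hint.const_mul 2)) fun x => ?_
          have h1 := h0 (x + y)
          have h2 := h0 (x - y)
          have h3 := h0 x
          simp only [secondDiff]
          rw [abs_le]
          constructor <;> linarith
      _ = 4 * ∫ x, η x := by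
          have hi3 : Integrable fun x => η (x + y) + η (x - y) := hi1.add hi2
          rw [integral_add hi3 (hint.const_mul 2), integral_add hi1 hi2,
            integral_const_mul, integral_add_right_eq_self, integral_sub_right_eq_self]
          ring
      _ ≤ _ := by
          have : 0 ≤ L * V := by positivity
          linarith

/-- Discrete integration by parts: the substitutions `x ↦ x ∓ y` move the shifts from `w` to `η`. -/
theorem integral_mul_secondDiff {η w : EuclideanSpace ℝ (Fin n) → ℝ}
    (hη : Continuous η) (hc : HasCompactSupport η) (hw : Continuous w)
    (y : EuclideanSpace ℝ (Fin n)) :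
    ∫ x, η x * secondDiff w x y = ∫ x, w x * secondDiff η x y := by
  have hcomp : ∀ z, HasCompactSupport fun x => η (x + z) := fun z =>
    hc.comp_homeomorph (Homeomorph.addRight z)
  have hi : ∀ z z', Integrable fun x => η (x + z) * w (x + z') := fun z z' =>
    Continuous.integrable_of_hasCompactSupport (by fun_prop) ((hcomp z).mul_right)
  have e1 : ∫ x, η x * w (x + y) = ∫ x, w x * η (x - y) := by
    rw [← integral_sub_right_eq_self (fun x => η x * w (x + y)) y]
    simp [mul_comm]
  have e2 : ∫ x, η x * w (x - y) = ∫ x, w x * η (x + y) := by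
    rw [← integral_add_right_eq_self (fun x => η x * w (x - y)) y]
    simp [mul_comm]
  have i1 : Integrable fun x => η x * w (x + y) := by simpa using hi 0 y
  have i2 : Integrable fun x => η x * w (x - y) := by simpa [sub_eq_add_neg] using hi 0 (-y)
  have i3 : Integrable fun x => η x * (2 * w x) := by
    simpa [mul_assoc, mul_comm, mul_left_comm] using (hi 0 0).const_mul 2
  have i4 : Integrable fun x => w x * η (x + y) := by simpa [mul_comm] using hi y 0
  have i5 : Integrable fun x => w x * η (x - y) := by
    simpa [sub_eq_add_neg, mul_comm] using hi (-y) 0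
  have i6 : Integrable fun x => w x * (2 * η x) := by
    simpa [mul_assoc, mul_comm, mul_left_comm] using (hi 0 0).const_mul 2
  have i7 : Integrable fun x => η x * w (x + y) + η x * w (x - y) := i1.add i2
  have i8 : Integrable fun x => w x * η (x + y) + w x * η (x - y) := i4.add i5
  simp only [secondDiff, mul_sub, mul_add]
  rw [integral_sub i7 i3, integral_sub i8 i6, integral_add i1 i2,
    integral_add i4 i5, e1, e2, add_comm]
  congr 2
  ext x
  ring

/-- The central estimate: a one-sided bound on `δ(w, ·, ·)` yields absolute integrability after
averaging in `x`, because the signed average is bounded by moving `δ` onto `η`. -/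
theorem integrable_mul_hessianIntegrand (hn : n ≠ 0) {σ : ℝ} (hσ0 : 0 < σ) (hσ2 : σ < 2)
    {η w : EuclideanSpace ℝ (Fin n) → ℝ} (hη : ContDiff ℝ 2 η) (hc : HasCompactSupport η)
    (h0 : ∀ x, 0 ≤ η x) (hw : Continuous w) {K : ℝ} (hK : ∀ x, |w x| ≤ K) {a : ℝ} (ha : 0 ≤ a)
    (hδ : ∀ x y, secondDiff w x y ≤ a * min (‖y‖ ^ 2) 1) (i j : Fin n) :
    Integrable (fun p : EuclideanSpace ℝ (Fin n) × EuclideanSpace ℝ (Fin n) =>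
      η p.1 * hessianIntegrand σ w p.1 i j p.2) (volume.prod volume) := by
  obtain ⟨C, hC0, hC⟩ := exists_integral_abs_secondDiff_le hη hc h0
  have hK0 : 0 ≤ K := (abs_nonneg _).trans (hK 0)
  have hηc := hη.continuous
  have hη1 : Integrable η := hηc.integrable_of_hasCompactSupport hc
  have hmeas : Measurable (fun p : EuclideanSpace ℝ (Fin n) × EuclideanSpace ℝ (Fin n) =>
      η p.1 * hessianIntegrand σ w p.1 i j p.2) := by
    unfold hessianIntegrand secondDiff
    have := hηc.measurable
    have := hw.measurable
    fun_prop
  have hδc : ∀ {v : EuclideanSpace ℝ (Fin n) → ℝ}, Continuous v → ∀ y,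
      Continuous fun x => secondDiff v x y := by
    intro v hv y
    unfold secondDiff
    fun_prop
  have hsec : ∀ y, Integrable fun x => η x * hessianIntegrand σ w x i j y := fun y => by
    refine Continuous.integrable_of_hasCompactSupport ?_ hc.mul_right
    have := hδc hw y
    unfold hessianIntegrand
    fun_prop
  -- The `x`-integral is taken first, at fixed `y`; only in this order can the second difference be
  -- transferred to `η`.
  refine (integrable_prod_iff' hmeas.aestronglyMeasurable).2 ⟨ae_of_all _ hsec, ?_⟩
  refine ((integrable_min_mul_kernel hn hσ0 hσ2).const_mul
    (2 * a * (∫ x, η x) + K * C)).mono'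
    (hmeas.norm.stronglyMeasurable.integral_prod_left (μ := volume)).aestronglyMeasurable
    (ae_of_all _ fun y => ?_)
  set m := min (‖y‖ ^ 2) 1 with hm
  have hm0 : 0 ≤ m := le_min (by positivity) zero_le_one
  set k := ‖y‖ ^ 2 / ‖y‖ ^ ((n : ℝ) + 2 + σ) with hk
  have hk0 : 0 ≤ k := by positivity
  have i1 : Integrable fun x => η x * secondDiff w x y :=
    Continuous.integrable_of_hasCompactSupport (hηc.mul (hδc hw y)) hc.mul_right
  have i2 : Integrable fun x => secondDiff η x y :=
    ((hη1.comp_add_right y).add (hη1.comp_sub_right y)).sub (hη1.const_mul 2)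
  have i3 : Integrable fun x => w x * secondDiff η x y :=
    i2.bdd_mul hw.aestronglyMeasurable (c := K) (ae_of_all _ hK)
  have hparts : -(K * (C * m)) ≤ ∫ x, η x * secondDiff w x y := by
    rw [integral_mul_secondDiff hηc hc hw]
    refine neg_le_of_abs_le ((abs_integral_le_integral_abs).trans ?_)
    calc ∫ x, |w x * secondDiff η x y| ≤ ∫ x, K * |secondDiff η x y| := by
          refine integral_mono i3.abs (i2.abs.const_mul _) fun x => ?_
          simp only [abs_mul]
          gcongr
          exact hK x
      _ ≤ _ := by
          rw [integral_const_mul]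
          gcongr
          exact hC y
  rw [Real.norm_of_nonneg (integral_nonneg fun _ => norm_nonneg _)]
  calc ∫ x, ‖η x * hessianIntegrand σ w x i j y‖
      ≤ ∫ x, (2 * a * m * η x - η x * secondDiff w x y) * k := by
        refine integral_mono (hsec y).norm (((hη1.const_mul _).sub i1).mul_const k) fun x => ?_
        have h1 : |secondDiff w x y| ≤ 2 * (a * m) - secondDiff w x y := by
          have h2 := hδ x y
          have h3 : 0 ≤ a * m := by positivity
          rw [abs_le]
          constructor <;> linarith
        simp only [norm_mul, Real.norm_eq_abs, abs_of_nonneg (h0 x)]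
        calc η x * |hessianIntegrand σ w x i j y|
            ≤ η x * ((2 * (a * m) - secondDiff w x y) * k) := by
              refine mul_le_mul_of_nonneg_left ?_ (h0 x)
              refine (abs_hessianIntegrand_le w x i j y).trans ?_
              gcongr
          _ = _ := by ring
    _ = (2 * a * m * (∫ x, η x) - ∫ x, η x * secondDiff w x y) * k := by
        rw [integral_mul_const, integral_sub (hη1.const_mul _) i1, integral_const_mul]
    _ ≤ (2 * a * m * (∫ x, η x) + K * (C * m)) * k := by
        gcongr
        linarith
    _ = _ := by ring

/-- Fubini with a bump equal to `1` on a unit ball; countably many such balls cover the space, so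
the exceptional null sets can be united. -/
theorem locallyIntegrable_integral_hessianIntegrand (hn : n ≠ 0) {σ : ℝ} (hσ0 : 0 < σ)
    (hσ2 : σ < 2) {w : EuclideanSpace ℝ (Fin n) → ℝ} (hw : Continuous w) {K : ℝ}
    (hK : ∀ x, |w x| ≤ K) {a : ℝ} (ha : 0 ≤ a)
    (hδ : ∀ x y, secondDiff w x y ≤ a * min (‖y‖ ^ 2) 1) (i j : Fin n) :
    LocallyIntegrable (fun x => ∫ y, hessianIntegrand σ w x i j y) ∧
      ∀ᵐ x, Integrable (hessianIntegrand σ w x i j) := by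
  have key : ∀ x₀ : EuclideanSpace ℝ (Fin n),
      IntegrableOn (fun x => ∫ y, hessianIntegrand σ w x i j y) (ball x₀ 1) ∧
      ∀ᵐ x, x ∈ ball x₀ 1 → Integrable (hessianIntegrand σ w x i j) := by
    intro x₀
    let η : ContDiffBump x₀ := ⟨1, 2, one_pos, one_lt_two⟩
    have hone : ∀ x ∈ ball x₀ 1, η x = 1 := fun x hx =>
      η.one_of_mem_closedBall (ball_subset_closedBall hx)
    have hint := integrable_mul_hessianIntegrand hn hσ0 hσ2 η.contDiff η.hasCompactSupport
      (fun _ => η.nonneg) hw hK ha hδ i j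
    constructor
    · refine hint.integral_prod_left.integrableOn.congr_fun (fun x hx => ?_) measurableSet_ball
      simp [hone x hx]
    · filter_upwards [hint.prod_right_ae] with x hx hmem
      simpa [hone x hmem] using hx
  refine ⟨fun x₀ => ⟨ball x₀ 1, ball_mem_nhds _ one_pos, (key x₀).1⟩, ?_⟩
  obtain ⟨s, hs, hcov⟩ := TopologicalSpace.countable_cover_nhds
    (fun x₀ : EuclideanSpace ℝ (Fin n) => ball_mem_nhds x₀ one_pos)
  have : ∀ᵐ x, ∀ x₀ ∈ s, x ∈ ball x₀ 1 → Integrable (hessianIntegrand σ w x i j) :=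
    (ae_ball_iff hs).2 fun x₀ _ => (key x₀).2
  filter_upwards [this] with x hx
  obtain ⟨x₀, hx₀, hmem⟩ := mem_iUnion₂.1 (hcov.symm ▸ mem_univ x)
  exact hx x₀ hx₀ hmem

/-! ### Mollification -/

/-- The rescaled mollifier `ε^{-n} φ(ε^{-1} ·)`. -/
noncomputable def scaledMollifier (φ : EuclideanSpace ℝ (Fin n) → ℝ) (ε : ℝ)
    (z : EuclideanSpace ℝ (Fin n)) : ℝ :=
  (ε ^ n)⁻¹ * φ (ε⁻¹ • z)

variable {φ : EuclideanSpace ℝ (Fin n) → ℝ} {ε : ℝ}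

theorem scaledMollifier_nonneg (hφ : IsMollifier φ) (hε : 0 < ε) (z : EuclideanSpace ℝ (Fin n)) :
    0 ≤ scaledMollifier φ ε z :=
  mul_nonneg (by positivity) (hφ.nonneg _)

theorem contDiff_scaledMollifier (hφ : IsMollifier φ) : ContDiff ℝ ∞ (scaledMollifier φ ε) :=
  contDiff_const.mul (hφ.smooth.comp (contDiff_const_smul _))

theorem hasCompactSupport_scaledMollifier (hφ : IsMollifier φ) (hε : 0 < ε) :
    HasCompactSupport (scaledMollifier φ ε) :=
  (hφ.compact.comp_smul (inv_ne_zero hε.ne')).mul_left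

theorem contDiff_scaledMollifier_sub (hφ : IsMollifier φ) (x : EuclideanSpace ℝ (Fin n)) :
    ContDiff ℝ ∞ fun s => scaledMollifier φ ε (x - s) :=
  (contDiff_scaledMollifier hφ).comp (contDiff_const.sub contDiff_id)

theorem hasCompactSupport_scaledMollifier_sub (hφ : IsMollifier φ) (hε : 0 < ε)
    (x : EuclideanSpace ℝ (Fin n)) : HasCompactSupport fun s => scaledMollifier φ ε (x - s) :=
  (hasCompactSupport_scaledMollifier hφ hε).comp_homeomorph (Homeomorph.subLeft x)

theorem integral_scaledMollifier_sub (hφ : IsMollifier φ) (hε : 0 < ε)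
    (x : EuclideanSpace ℝ (Fin n)) : ∫ s, scaledMollifier φ ε (x - s) = 1 := by
  rw [integral_sub_left_eq_self (scaledMollifier φ ε) volume x]
  unfold scaledMollifier
  rw [integral_const_mul, Measure.integral_comp_inv_smul_of_nonneg volume φ hε.le, hφ.integral_eq,
    finrank_euclideanSpace_fin]
  have : ε ^ n ≠ 0 := by positivity
  simp [this]

/-- Puts the shift on `w`, so that the three terms of a second difference share one kernel. -/
theorem mollify_add (w : EuclideanSpace ℝ (Fin n) → ℝ) (x z : EuclideanSpace ℝ (Fin n)) :
    mollify φ ε w (x + z) = ∫ s, scaledMollifier φ ε (x - s) * w (s + z) := by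
  have : mollify φ ε w (x + z) = ∫ t, w t * scaledMollifier φ ε (x + z - t) := rfl
  rw [this, ← integral_add_right_eq_self _ z]
  refine integral_congr_ae (ae_of_all _ fun s => ?_)
  dsimp only
  rw [mul_comm, add_sub_add_right_eq_sub]

theorem secondDiff_mollify (hφ : IsMollifier φ) (hε : 0 < ε) {w : EuclideanSpace ℝ (Fin n) → ℝ}
    (hw : Continuous w) (x y : EuclideanSpace ℝ (Fin n)) :
    Integrable (fun s => scaledMollifier φ ε (x - s) * secondDiff w s y) ∧
    secondDiff (mollify φ ε w) x y = ∫ s, scaledMollifier φ ε (x - s) * secondDiff w s y := by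
  have hi : ∀ z, Integrable fun s => scaledMollifier φ ε (x - s) * w (s + z) := fun z =>
    Continuous.integrable_of_hasCompactSupport
      ((contDiff_scaledMollifier_sub hφ x).continuous.mul (by fun_prop))
      (hasCompactSupport_scaledMollifier_sub hφ hε x).mul_right
  have h2 : Integrable fun s =>
      scaledMollifier φ ε (x - s) * w (s + y) + scaledMollifier φ ε (x - s) * w (s + -y) :=
    (hi y).add (hi (-y))
  have e : (fun s => scaledMollifier φ ε (x - s) * secondDiff w s y) = fun s =>
      scaledMollifier φ ε (x - s) * w (s + y) + scaledMollifier φ ε (x - s) * w (s + -y) -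
        2 * (scaledMollifier φ ε (x - s) * w (s + 0)) := by
    ext s
    rw [secondDiff, sub_eq_add_neg s y, add_zero]
    ring
  rw [e]
  refine ⟨h2.sub ((hi 0).const_mul 2), ?_⟩
  rw [integral_sub h2 ((hi 0).const_mul 2), integral_add (hi y) (hi (-y)), integral_const_mul,
    ← mollify_add, ← mollify_add, ← mollify_add, secondDiff, sub_eq_add_neg x y, add_zero]

theorem secondDiff_mollify_le (hφ : IsMollifier φ) (hε : 0 < ε)
    {w : EuclideanSpace ℝ (Fin n) → ℝ} (hw : Continuous w) {y : EuclideanSpace ℝ (Fin n)} {b : ℝ}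
    (hb : ∀ x, secondDiff w x y ≤ b) (x : EuclideanSpace ℝ (Fin n)) :
    secondDiff (mollify φ ε w) x y ≤ b := by
  obtain ⟨h1, h2⟩ := secondDiff_mollify hφ hε hw x y
  have h3 : Integrable fun s => scaledMollifier φ ε (x - s) :=
    (contDiff_scaledMollifier_sub hφ x).continuous.integrable_of_hasCompactSupport
      (hasCompactSupport_scaledMollifier_sub hφ hε x)
  calc secondDiff (mollify φ ε w) x y
      = ∫ s, scaledMollifier φ ε (x - s) * secondDiff w s y := h2
    _ ≤ ∫ s, scaledMollifier φ ε (x - s) * b := integral_mono h1 (h3.mul_const b) fun s =>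
        mul_le_mul_of_nonneg_left (hb s) (scaledMollifier_nonneg hφ hε _)
    _ = b := by rw [integral_mul_const, integral_scaledMollifier_sub hφ hε, one_mul]

/-- The mollifier centred at `x` is itself an admissible cutoff, so Fubini applies at every `x` and
shows that mollification commutes with `D^σ`. -/
theorem integral_hessianIntegrand_mollify (hn : n ≠ 0) {σ : ℝ} (hσ0 : 0 < σ)
    (hσ2 : σ < 2) (hφ : IsMollifier φ) (hε : 0 < ε) {w : EuclideanSpace ℝ (Fin n) → ℝ}
    (hw : Continuous w) {K : ℝ} (hK : ∀ x, |w x| ≤ K) {a : ℝ} (ha : 0 ≤ a)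
    (hδ : ∀ x y, secondDiff w x y ≤ a * min (‖y‖ ^ 2) 1) (x : EuclideanSpace ℝ (Fin n))
    (i j : Fin n) :
    Integrable (hessianIntegrand σ (mollify φ ε w) x i j) ∧
    ∫ y, hessianIntegrand σ (mollify φ ε w) x i j y =
      ∫ s, scaledMollifier φ ε (x - s) * ∫ y, hessianIntegrand σ w s i j y := by
  have hint := integrable_mul_hessianIntegrand hn hσ0 hσ2
    (contDiff_infty.1 (contDiff_scaledMollifier_sub (ε := ε) hφ x) 2)
    (hasCompactSupport_scaledMollifier_sub hφ hε x)
    (fun s => scaledMollifier_nonneg hφ hε (x - s)) hw hK ha hδ i j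
  have e : hessianIntegrand σ (mollify φ ε w) x i j =
      fun y => ∫ s, scaledMollifier φ ε (x - s) * hessianIntegrand σ w s i j y := by
    ext y
    rw [hessianIntegrand, (secondDiff_mollify hφ hε hw x y).2, mul_div_assoc, ← integral_mul_const]
    refine integral_congr_ae (ae_of_all _ fun s => ?_)
    simp only [hessianIntegrand]
    ring
  rw [e]
  refine ⟨hint.integral_prod_right, ?_⟩
  rw [← integral_integral_swap hint]
  simp only [integral_const_mul]

/-- Convergence holds at Lebesgue points of `g`: the kernel has mass `1`, lives in `closedBall x ε`,
and is bounded by a constant over the volume of that ball. -/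
theorem ae_tendsto_integral_scaledMollifier_mul (hφ : IsMollifier φ)
    {g : EuclideanSpace ℝ (Fin n) → ℝ} (hg : LocallyIntegrable g) :
    ∀ᵐ x, Filter.Tendsto (fun ε => ∫ s, scaledMollifier φ ε (x - s) * g s) (𝓝[>] 0)
      (𝓝 (g x)) := by
  obtain ⟨M, hM⟩ := hφ.smooth.continuous.bounded_above_of_compact_support hφ.compact
  filter_upwards [(Besicovitch.vitaliFamily volume).ae_tendsto_average_norm_sub hg] with x hx
  have hlim := hx.comp (Besicovitch.tendsto_filterAt volume x)
  simp only [← smul_eq_mul (scaledMollifier _ _ _)]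
  refine tendsto_integral_smul_of_tendsto_average_norm_sub
    (M * volume.real (closedBall (0 : EuclideanSpace ℝ (Fin n)) 1)) hlim
    (Filter.Eventually.of_forall fun ε => hg.integrableOn_isCompact (isCompact_closedBall _ _))
    ?_ ?_ ?_
  · refine tendsto_const_nhds.congr' ?_
    filter_upwards [self_mem_nhdsWithin] with ε hε
    exact (integral_scaledMollifier_sub hφ hε x).symm
  · filter_upwards [self_mem_nhdsWithin] with ε hε s hs
    have hε' : 0 < ε := hε
    have h1 : φ (ε⁻¹ • (x - s)) ≠ 0 := right_ne_zero_of_mul hs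
    have h2 := hφ.support (subset_tsupport φ h1)
    rw [mem_ball_zero_iff, norm_smul, Real.norm_of_nonneg (by positivity),
      inv_mul_lt_iff₀ hε', mul_one] at h2
    rw [mem_closedBall, dist_comm, dist_eq_norm]
    exact h2.le
  · filter_upwards [self_mem_nhdsWithin] with ε hε s
    have hε' : 0 < ε := hε
    have hV : 0 < volume.real (closedBall (0 : EuclideanSpace ℝ (Fin n)) 1) :=
      ENNReal.toReal_pos (measure_closedBall_pos _ _ one_pos).ne' measure_closedBall_lt_top.ne
    have hvol : volume.real (closedBall x ε) =
        ε ^ n * volume.real (closedBall (0 : EuclideanSpace ℝ (Fin n)) 1) := by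
      rw [Measure.addHaar_real_closedBall' _ _ hε'.le, finrank_euclideanSpace_fin]
    rw [hvol, mul_div_mul_right _ _ hV.ne', scaledMollifier, abs_mul,
      abs_of_nonneg (by positivity : (0 : ℝ) ≤ (ε ^ n)⁻¹), inv_mul_eq_div]
    gcongr
    exact hM _

/-! ### Viscosity supersolutions -/

/-- Finiteness of the infimum is automatic, since ellipticity bounds the entries of `A β x`
uniformly in `β`. -/
theorem opDefinedAt_iff {B : Type*} {σ lam Lam : ℝ} (hσ : 0 < σ)
    {A : B → EuclideanSpace ℝ (Fin n) → Matrix (Fin n) (Fin n) ℝ}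
    (hA : ∀ β x, A β x ∈ ellipticSet n σ lam Lam) {u : EuclideanSpace ℝ (Fin n) → ℝ}
    {x : EuclideanSpace ℝ (Fin n)} :
    OpDefinedAt σ A u x ↔ ∀ i j, Integrable (hessianIntegrand σ u x i j) :=
  ⟨fun h => h.1, fun h => ⟨h, bddBelow_trace_mul (fun β => abs_entry_le hσ (hA β x)) _⟩⟩

open Classical in
theorem integrable_hessianIntegrand_piecewise (hn : n ≠ 0) {σ : ℝ} (hσ0 : 0 < σ) (hσ2 : σ < 2)
    {u φ : EuclideanSpace ℝ (Fin n) → ℝ} {N : Set (EuclideanSpace ℝ (Fin n))}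
    {x : EuclideanSpace ℝ (Fin n)} (hu : Measurable u) (hb : ∃ K : ℝ, ∀ y, |u y| ≤ K)
    (hN : IsOpen N) (hx : x ∈ N) (hφ : ContDiffOn ℝ 2 φ (closure N))
    (hφb : ∃ K : ℝ, ∀ y ∈ N, |φ y| ≤ K) (i j : Fin n) :
    Integrable (hessianIntegrand σ (N.piecewise φ u) x i j) := by
  obtain ⟨K, hK⟩ := hb
  obtain ⟨K', hK'⟩ := hφb
  have hφN : ContDiffOn ℝ 2 φ N := hφ.mono subset_closure
  have hmeas : Measurable (N.piecewise φ u) := by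
    -- `φ` is arbitrary off `closure N`, so measurability is first established for its extension by
    -- `0`.
    have h1 : Measurable (N.piecewise φ fun _ => 0) :=
      hφN.continuousOn.measurable_piecewise continuousOn_const hN.measurableSet
    have h2 : Measurable (N.piecewise (N.piecewise φ fun _ => 0) u) :=
      h1.piecewise hN.measurableSet hu
    convert h2 using 1
    ext y
    by_cases hy : y ∈ N <;> simp [hy]
  refine integrable_hessianIntegrand_of_contDiffAt hn hσ0 hσ2 (K := max K K') hmeas (fun y => ?_)
    (hφN.contDiffAt (hN.mem_nhds hx)) ?_ i j
  · by_cases hy : y ∈ N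
    · simpa [hy] using Or.inr (hK' y hy)
    · simpa [hy] using Or.inl (hK y)
  · filter_upwards [hN.mem_nhds hx] with y hy
    simp [hy]

theorem IsViscositySupersolution.infConv (hn : n ≠ 0) {B : Type*} [Nonempty B] {σ lam Lam : ℝ}
    (hσ0 : 0 < σ) (hσ2 : σ < 2)
    {A : B → EuclideanSpace ℝ (Fin n) → Matrix (Fin n) (Fin n) ℝ}
    (hA : ∀ β x, A β x ∈ ellipticSet n σ lam Lam) (hinv : TranslationInvariant σ A)
    {u : EuclideanSpace ℝ (Fin n) → ℝ} {f : EuclideanSpace ℝ (Fin n) → EReal}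
    (hu : IsViscositySupersolution σ A u f) {h : ℝ} (hh : 0 < h) :
    IsViscositySupersolution σ A (infConv h u)
      fun x => ⨆ y ∈ closedBall x (2 * √(h * supNorm u)), f y := by
  classical
  have hK := abs_le_supNorm hu.bounded
  have hcont := continuous_infConv hh hu.lsc hK
  refine ⟨hcont.lowerSemicontinuous, ⟨_, abs_infConv_le hh hK⟩, ?_⟩
  intro x N φ hN hx hφ hφb hux hle
  obtain ⟨z, hz, hmin⟩ := exists_infConv_eq hh hu.lsc hK x
  -- The translation `t` carries the contact point `x` to the minimizer `z`, and `c` is the penalty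
  -- paid there.
  set t := z - x with ht
  set c := 1 / (2 * h) * ‖x - z‖ ^ 2 with hc
  set N' : Set (EuclideanSpace ℝ (Fin n)) := (fun w => w - t) ⁻¹' N with hN'
  set ψ : EuclideanSpace ℝ (Fin n) → ℝ := fun w => φ (w - t) - c with hψ
  have hxz : x = z - t := by rw [ht]; abel
  have hN'o : IsOpen N' := hN.preimage (by fun_prop)
  have hzN' : z ∈ N' := by rw [hN', mem_preimage, ← hxz]; exact hx
  have hcl : closure N' = (fun w => w - t) ⁻¹' closure N :=
    ((Homeomorph.subRight t).preimage_closure N).symm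
  have hψd : ContDiffOn ℝ 2 ψ (closure N') := by
    rw [hcl]
    exact (hφ.comp (contDiff_id.sub contDiff_const).contDiffOn fun w hw => hw).sub contDiffOn_const
  have hψb : ∃ K : ℝ, ∀ y ∈ N', |ψ y| ≤ K := by
    obtain ⟨K, hK'⟩ := hφb
    exact ⟨K + |c|, fun y hy => (abs_sub _ _).trans (by gcongr; exact hK' _ hy)⟩
  have hshift : ∀ w, NonlocalInfConv.infConv h u (w - t) ≤ u w + c := by
    intro w
    have := infConv_le hh hK (w - t) w
    rwa [show w - t - w = x - z by rw [ht]; abel] at this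
  have htest := hu.test z N' ψ hN'o hzN' hψd hψb
    (by simp only [hψ]; rw [← hxz, ← hux, hmin]; ring)
    (fun y hy => by
      have h1 := hle _ hy
      have h2 := hshift y
      simp only [hψ]
      linarith)
  have hi1 := integrable_hessianIntegrand_piecewise hn hσ0 hσ2 hcont.measurable
    ⟨_, abs_infConv_le hh hK⟩ hN hx hφ hφb
  have hi2 := integrable_hessianIntegrand_piecewise hn hσ0 hσ2 hu.lsc.measurable
    hu.bounded hN'o hzN' hψd hψb
  have hsd : ∀ y, secondDiff (fun w => N'.piecewise ψ u (w + t)) x y =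
      secondDiff (N'.piecewise ψ u) z y := by
    intro y
    simp only [secondDiff]
    rw [show x + y + t = z + y by rw [ht]; abel, show x - y + t = z - y by rw [ht]; abel,
      show x + t = z by rw [ht]; abel]
  -- This global inequality is an equality at `x` by `heq`, so the second differences at `x` are
  -- ordered for every `y`.
  have hcmp : ∀ w, N.piecewise φ (NonlocalInfConv.infConv h u) w ≤
      N'.piecewise ψ u (w + t) + c := by
    intro w
    have hmem : w + t ∈ N' ↔ w ∈ N := by simp [hN']
    by_cases hw : w ∈ N
    · rw [piecewise_eq_of_mem _ _ _ hw, piecewise_eq_of_mem _ _ _ (hmem.2 hw)]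
      simp [hψ]
    · rw [piecewise_eq_of_notMem _ _ _ hw, piecewise_eq_of_notMem _ _ _ (hmem.not.2 hw)]
      simpa using hshift (w + t)
  have heq : N.piecewise φ (NonlocalInfConv.infConv h u) x = N'.piecewise ψ u (x + t) + c := by
    rw [show x + t = z by rw [ht]; abel, piecewise_eq_of_mem _ _ _ hx,
      piecewise_eq_of_mem _ _ _ hzN']
    simp only [hψ]
    rw [← hxz]
    ring
  have hi3 : ∀ i j, Integrable
      (hessianIntegrand σ (fun w => N'.piecewise ψ u (w + t)) x i j) := by
    intro i j
    refine (hi2 i j).congr (ae_of_all _ fun y => ?_)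
    simp only [hessianIntegrand, hsd]
  have hop : nonlocalOp σ A (N.piecewise φ (NonlocalInfConv.infConv h u)) x ≤
      nonlocalOp σ A (N'.piecewise ψ u) z := by
    have hz' : x + t = z := by rw [ht]; abel
    -- Translation invariance replaces the matrices `A β z` by `A β x`, so that both operators are
    -- compared with the same coefficients.
    have hinv' := hinv (N'.piecewise ψ u) x t (by rw [hz']; exact (opDefinedAt_iff hσ0 hA).2 hi2)
    rw [hz'] at hinv'
    rw [hinv']
    refine ciInf_mono ((opDefinedAt_iff hσ0 hA).2 hi1).2 fun β => ?_
    refine trace_mul_fracHessian_mono hσ0 (hA β x).1 hi1 hi3 fun y => ?_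
    have h1 := hcmp (x + y)
    have h2 := hcmp (x - y)
    simp only [secondDiff]
    linarith
  refine (EReal.coe_le_coe_iff.2 (by convert hop)).trans (htest.trans ?_)
  exact le_iSup₂_of_le z (by rwa [mem_closedBall, dist_comm, dist_eq_norm]) le_rfl

end

end NonlocalInfConv

/-! ### Proof of the three assertions -/

open NonlocalInfConv MeasureTheory

theorem proposition2p3 (n : ℕ) (hn : 2 ≤ n) (σ : ℝ) (hσ0 : 0 < σ) (hσ2 : σ < 2)
    (lam Lam : ℝ) (hlam : 0 < lam) (hLam : 0 < Lam) :
    ∃ C : ℝ, 0 < C ∧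
      ∀ (B : Type*) [Nonempty B]
        (A : B → EuclideanSpace ℝ (Fin n) → Matrix (Fin n) (Fin n) ℝ),
        (∀ β x, A β x ∈ NonlocalInfConv.ellipticSet n σ lam Lam) →
        NonlocalInfConv.TranslationInvariant σ A →
      ∀ (u f : EuclideanSpace ℝ (Fin n) → ℝ),
        NonlocalInfConv.IsViscositySupersolution σ A u (fun x => (f x : EReal)) →
      ∀ h : ℝ, 0 < h →
        -- (i)
        (∀ᵐ x, NonlocalInfConv.OpDefinedAt σ A (NonlocalInfConv.infConv h u) x) ∧
        -- (ii)
        NonlocalInfConv.IsViscositySupersolution σ A (NonlocalInfConv.infConv h u)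
          (fun x => ⨆ y ∈ Metric.closedBall x (2 * √(h * NonlocalInfConv.supNorm u)),
            (f y : EReal)) ∧
        -- (iii)
        ∀ φ : EuclideanSpace ℝ (Fin n) → ℝ, NonlocalInfConv.IsMollifier φ →
          (∀ ε : ℝ, 0 < ε → ∀ x,
            NonlocalInfConv.OpDefinedAt σ A
              (NonlocalInfConv.mollify φ ε (NonlocalInfConv.infConv h u)) x ∧
            NonlocalInfConv.nonlocalOp σ A
              (NonlocalInfConv.mollify φ ε (NonlocalInfConv.infConv h u)) x
                ≤ C * max h⁻¹ (NonlocalInfConv.supNorm u)) ∧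
          ∀ᵐ x, Filter.Tendsto
            (fun ε => NonlocalInfConv.nonlocalOp σ A
              (NonlocalInfConv.mollify φ ε (NonlocalInfConv.infConv h u)) x)
            (𝓝[>] 0)
            (𝓝 (NonlocalInfConv.nonlocalOp σ A (NonlocalInfConv.infConv h u) x)) := by
  have hn0 : n ≠ 0 := by lia
  set W : ℝ := ∫ y : EuclideanSpace ℝ (Fin n),
    min (‖y‖ ^ 2) 1 * (‖y‖ ^ 2 / ‖y‖ ^ ((n : ℝ) + 2 + σ)) with hW
  have hW0 : 0 ≤ W := integral_nonneg fun y => by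
    have : 0 ≤ min (‖y‖ ^ 2) 1 := le_min (by positivity) zero_le_one
    positivity
  -- The factor `4` comes from `max h⁻¹ (4‖u‖_∞) ≤ 4 max h⁻¹ ‖u‖_∞`.
  set c : ℝ := normConst n σ / 2 * (4 * ((n + σ) * Lam / σ) * W) with hc
  have hc0 : 0 ≤ c := by
    have := normConst_nonneg (n := n) hσ0
    positivity
  -- Adding `1` makes the constant strictly positive from `0 ≤ c` alone.
  refine ⟨c + 1, by positivity, ?_⟩
  intro B _ A hA hinv u f hu h hh
  have hK := abs_le_supNorm hu.bounded
  have hcont := continuous_infConv hh hu.lsc hK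
  have hbdd := abs_infConv_le hh hK
  have hh' : 0 < h⁻¹ := inv_pos.2 hh
  set a := max h⁻¹ (4 * supNorm u) with ha
  have ha0 : 0 ≤ a := hh'.le.trans (le_max_left _ _)
  have hδ : ∀ x y, secondDiff (infConv h u) x y ≤ a * min (‖y‖ ^ 2) 1 := fun x y =>
    secondDiff_le_min hbdd x y (secondDiff_infConv_le hh hK x y)
  have hloc := locallyIntegrable_integral_hessianIntegrand hn0 hσ0 hσ2 hcont hbdd ha0 hδ
  refine ⟨?_, hu.infConv hn0 hσ0 hσ2 hA hinv hh, fun φ hφ => ⟨fun ε hε x => ?_, ?_⟩⟩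
  · have : ∀ᵐ x, ∀ i j, Integrable (hessianIntegrand σ (infConv h u) x i j) :=
      ae_all_iff.2 fun i => ae_all_iff.2 fun j => (hloc i j).2
    filter_upwards [this] with x hx using (opDefinedAt_iff hσ0 hA).2 hx
  · have hint := fun i j =>
      (integral_hessianIntegrand_mollify hn0 hσ0 hσ2 hφ hε hcont hbdd ha0 hδ x i j).1
    have hdef : OpDefinedAt σ A (mollify φ ε (infConv h u)) x := (opDefinedAt_iff hσ0 hA).2 hint
    refine ⟨hdef, ?_⟩
    -- For an upper bound on the infimum any single `β` is enough.
    obtain ⟨β⟩ := ‹Nonempty B›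
    have hm0 : 0 ≤ max h⁻¹ (supNorm u) := hh'.le.trans (le_max_left _ _)
    have ham : a ≤ 4 * max h⁻¹ (supNorm u) := by
      refine max_le ?_ (by gcongr; exact le_max_right _ _)
      linarith [le_max_left h⁻¹ (supNorm u)]
    calc nonlocalOp σ A (mollify φ ε (infConv h u)) x
        ≤ (A β x * fracHessian σ (mollify φ ε (infConv h u)) x).trace := ciInf_le hdef.2 β
      _ ≤ normConst n σ / 2 * (4 * max h⁻¹ (supNorm u) * ((n + σ) * Lam / σ) * W) :=
          trace_mul_fracHessian_le hn0 hσ0 hσ2 (hA β x) hint (by positivity) fun y =>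
            secondDiff_mollify_le hφ hε hcont (fun x => (hδ x y).trans (by
              have : 0 ≤ min (‖y‖ ^ 2) 1 := le_min (by positivity) zero_le_one
              gcongr)) x
      _ = c * max h⁻¹ (supNorm u) := by rw [hc]; ring
      _ ≤ (c + 1) * max h⁻¹ (supNorm u) := by gcongr; linarith
  · have : ∀ᵐ x, ∀ i j, Filter.Tendsto (fun ε => ∫ s, scaledMollifier φ ε (x - s) *
        ∫ y, hessianIntegrand σ (infConv h u) s i j y) (𝓝[>] 0)
        (𝓝 (∫ y, hessianIntegrand σ (infConv h u) x i j y)) :=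
      ae_all_iff.2 fun i => ae_all_iff.2 fun j =>
        ae_tendsto_integral_scaledMollifier_mul hφ (hloc i j).1
    filter_upwards [this] with x hx
    refine tendsto_iInf_trace_mul (fun β => abs_entry_le hσ0 (hA β x)) fun i j => ?_
    refine ((hx i j).const_mul (normConst n σ / 2)).congr' ?_
    filter_upwards [self_mem_nhdsWithin] with ε hε
    rw [fracHessian, Matrix.of_apply,
      (integral_hessianIntegrand_mollify hn0 hσ0 hσ2 hφ hε hcont hbdd ha0 hδ x i j).2]
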